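/- **Setting.** Let $d>2$ and $M=\mathbb R^d$ with its Euclidean norm. Let $G=(V,E)$ be a finite multigraph without self-loops (parallel edges are allowed), with an arbitrary orientation of its edges. A subgraph $g\subseteq G$ is determined by its edge set $E(g)\subseteq E$. Let $h_1(g)$ be its first Betti number and $\omega(g)=d\,h_1(g)-2|E(g)|$. Call $g$ divergent if $\omega(g)\ge 0$, and call $G$ at most logarithmic if $\omega(g)\le 0$ for all $g\subseteq G$. Let $\mathcal D$ be the set of divergent subgraphs of $G$ with at least one edge. Fix $v_0\in V$ and put $V'=V\setminus\{v_0\}$ and $X^G=M^{V'}$. For $e\in E$ and $v\in V$ let $(v:e)=1$ if $e$ starts at $v$, $(v:e)=-1$ if $e$ ends at $v$, and $(v:e)=0$ otherwise. Set $$v_G(x)=\prod_{e\in E}\Big|\sum_{v\in V'}(v:e)\,x_v\Big|^{2-d}.$$ Let $A_e\subseteq (X^G)^*$ be the space of linear forms $x\mapsto\sum_{i=1}^d\alpha_i\sum_{v\in V'}(v:e)\,x_v^i$ with $\alpha\in\mathbb R^d$, let $A_g=\sum_{e\in E(g)}A_e$, and let $A^\perp\subseteq X^G$ denote the common zero set of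 the forms in $A$. Put $$X^G_{\mathrm s}=\bigcup_{e\in E}A_e^\perp,\qquad X^G_{\mathcal D}=\bigcup_{g\in\mathcal D}A_g^\perp .$$ **Proposition 2.2.** Let $G$ be connected and at most logarithmic. Then $v_G$ is a well-defined distribution on $X^G\setminus X^G_{\mathcal D}$: it is locally integrable there, and $\varphi\mapsto\int v_G\,\varphi\,dx$ is a continuous linear functional on the test functions on $X^G\setminus X^G_{\mathcal D}$. The singular support of this distribution (the set of points of $X^G\setminus X^G_{\mathcal D}$ that have no open neighbourhood on which it is given by a smooth function) is $X^G_{\mathrm s}\setminus X^G_{\mathcal D}$. Moreover $X^G_{\mathcal D}$ is exactly the locus where local integrability fails (power counting): $v_G$ is not integrable on any neighbourhood of a point of $X^G_{\mathcal D}$. -/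

import Mathlib

open MeasureTheory TopologicalSpace Topology
open scoped Distributions ContDiff

noncomputable section

/-! ### Graphs -/

/-- A finite multigraph without self-loops on the vertex set `V` with edges indexed by `E`
(parallel edges are allowed), together with an orientation of every edge from `src` to `tgt`. -/
structure OrientedMultigraph (V E : Type*) where
  src : E → V
  tgt : E → V
  src_ne_tgt : ∀ e, src e ≠ tgt e

namespace OrientedMultigraph

variable {V E : Type*} [Fintype V] [DecidableEq V]

/-- The simple graph in which two vertices are adjacent if some edge joins them. -/
def toSimpleGraph (G : OrientedMultigraph V E) : SimpleGraph V :=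
  SimpleGraph.fromRel fun u v => ∃ e, G.src e = u ∧ G.tgt e = v

/-- Connectedness (which includes that there is at least one vertex). -/
def IsConnected (G : OrientedMultigraph V E) : Prop := G.toSimpleGraph.Connected

/-- The sign `(v : e)`: `1` if `e` starts at `v`, `-1` if `e` ends at `v`, and `0` otherwise. -/
def sign (G : OrientedMultigraph V E) (v : V) (e : E) : ℝ :=
  if G.src e = v then 1 else if G.tgt e = v then -1 else 0

/-- The coboundary `δ : ℝ^V → ℝ^{E(g)}`, `δ(v) = ∑_{e ∈ E(g)} (v : e) e`, of the subgraph `g`.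
A subgraph is determined by its set of edges; isolated vertices play no role. -/
def coboundary (G : OrientedMultigraph V E) (g : Finset E) : (V → ℝ) →ₗ[ℝ] (g → ℝ) :=
  Matrix.mulVecLin (Matrix.of fun (e : g) (v : V) => G.sign v e)

/-- The first Betti number `h₁(g)` of the subgraph `g`: the dimension of
`H¹(g, ℝ) = coker (δ : ℝ^V → ℝ^{E(g)})`. -/
def bettiOne (G : OrientedMultigraph V E) (g : Finset E) : ℕ :=
  Module.finrank ℝ ((g → ℝ) ⧸ LinearMap.range (G.coboundary g))

/-- The superficial degree of divergence `ω(g) = d h₁(g) - 2 |E(g)|`. -/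
def degDiv (G : OrientedMultigraph V E) (d : ℕ) (g : Finset E) : ℤ :=
  (d : ℤ) * G.bettiOne g - 2 * g.card

/-- `g` is divergent if `ω(g) ≥ 0`. -/
def IsDivergent (G : OrientedMultigraph V E) (d : ℕ) (g : Finset E) : Prop :=
  0 ≤ G.degDiv d g

/-- `G` is at most logarithmic if `ω(g) ≤ 0` for all subgraphs `g`. -/
def IsAtMostLogarithmic (G : OrientedMultigraph V E) (d : ℕ) : Prop :=
  ∀ g : Finset E, G.degDiv d g ≤ 0

end OrientedMultigraph

/-! ### The position space, the Feynman kernel and the arrangements -/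

/-- The space `X^G = M^{V'}`, where `M = ℝ^d` is Euclidean spacetime and `V' = V \ {v₀}`. -/
abbrev PositionSpace {V : Type*} (v₀ : V) (d : ℕ) : Type _ :=
  {v : V // v ≠ v₀} → EuclideanSpace ℝ (Fin d)

/-- The massless propagator `△(x) = 1 / |x|^{d-2}` on `ℝ^d`. -/
def propagator (d : ℕ) (x : EuclideanSpace ℝ (Fin d)) : ℝ :=
  1 / ‖x‖ ^ ((d : ℤ) - 2)

namespace OrientedMultigraph

variable {V E : Type*} [Fintype V] [DecidableEq V]

/-- `v_G(x) = ∏_{e ∈ E} △ (∑_{v ∈ V'} (v : e) x_v)`. -/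
def feynmanKernel [Fintype E] (G : OrientedMultigraph V E) (v₀ : V) (d : ℕ)
    (x : PositionSpace v₀ d) : ℝ :=
  ∏ e : E, propagator d (∑ v : {v : V // v ≠ v₀}, G.sign v e • x v)

/-- The linear form `ω_e` on `ℝ^{V'}`. -/
def edgeForm (G : OrientedMultigraph V E) (v₀ : V) (e : E) :
    ({v : V // v ≠ v₀} → ℝ) →ₗ[ℝ] ℝ :=
  ∑ v : {v : V // v ≠ v₀}, G.sign v e • LinearMap.proj v

/-- The subspace `A_e = {x ↦ ∑ᵢ αᵢ ω_e(xⁱ)}` of the dual of `X^G`, where `xⁱ` collects the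
`i`-th coordinates of the `x_v`. -/
def edgeSpace (G : OrientedMultigraph V E) (v₀ : V) (d : ℕ) (e : E) :
    Submodule ℝ (Module.Dual ℝ (PositionSpace v₀ d)) where
  carrier := {f | ∃ α : Fin d → ℝ, ∀ x, f x = ∑ i, α i * G.edgeForm v₀ e (fun v => x v i)}
  zero_mem' := ⟨0, fun x => by simp⟩
  add_mem' := by
    rintro f f' ⟨α, hα⟩ ⟨β, hβ⟩
    exact ⟨α + β, fun x => by simp [hα, hβ, add_mul, Finset.sum_add_distrib]⟩
  smul_mem' := by
    rintro c f ⟨α, hα⟩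
    exact ⟨c • α, fun x => by simp [hα, Finset.mul_sum, mul_assoc]⟩

/-- `A_g = ∑_{e ∈ E(g)} A_e`. -/
def subgraphSpace (G : OrientedMultigraph V E) (v₀ : V) (d : ℕ) (g : Finset E) :
    Submodule ℝ (Module.Dual ℝ (PositionSpace v₀ d)) :=
  ⨆ e ∈ g, G.edgeSpace v₀ d e

/-- The singular locus `X_s = ⋃_{e ∈ E} A_e^⊥`. -/
def singularLocus (G : OrientedMultigraph V E) (v₀ : V) (d : ℕ) : Set (PositionSpace v₀ d) :=
  ⋃ e : E, ((G.edgeSpace v₀ d e).dualCoannihilator : Set (PositionSpace v₀ d))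

/-- The divergent locus `X_𝓓 = ⋃_g A_g^⊥`, over the divergent subgraphs `g` with at least one
edge (the empty graph, for which `A_g^⊥` is the whole space, is left out). -/
def divergentLocus (G : OrientedMultigraph V E) (v₀ : V) (d : ℕ) : Set (PositionSpace v₀ d) :=
  ⋃ (g : Finset E) (_ : g.Nonempty ∧ G.IsDivergent d g),
    ((G.subgraphSpace v₀ d g).dualCoannihilator : Set (PositionSpace v₀ d))

theorem isClosed_divergentLocus [Finite E] (G : OrientedMultigraph V E) (v₀ : V) (d : ℕ) :
    IsClosed (G.divergentLocus v₀ d) := by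
  refine isClosed_iUnion_of_finite fun g => isClosed_iUnion_of_finite fun _ => ?_
  exact Submodule.closed_of_finiteDimensional _

/-- The open set `X^G \ X_𝓓`. -/
def convergentRegion [Finite E] (G : OrientedMultigraph V E) (v₀ : V) (d : ℕ) :
    Opens (PositionSpace v₀ d) :=
  ⟨(G.divergentLocus v₀ d)ᶜ, (G.isClosed_divergentLocus v₀ d).isOpen_compl⟩

end OrientedMultigraph

/-! ### Kernels and singular support of distributions -/

section Kernel

variable {X : Type*} [NormedAddCommGroup X] [NormedSpace ℝ X] [MeasureSpace X] {Ω : Opens X}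

/-- On the open set `U ⊆ Ω`, the distribution `T` is given by the function `f`: `f` is locally
integrable on `U` and `⟨T | φ⟩ = ∫ f φ` for all test functions `φ` supported in `U`. -/
def IsGivenByOn (T : 𝓓'(Ω, ℝ)) (f : X → ℝ) (U : Set X) : Prop :=
  LocallyIntegrableOn f U volume ∧
    ∀ φ : 𝓓(Ω, ℝ), tsupport φ ⊆ U → T φ = ∫ x, f x * φ x

/-- The singular support of a distribution on `Ω`: the points of `Ω` without an open neighbourhood
in `Ω` on which the distribution is given by a smooth function. -/
def singularSupport (T : 𝓓'(Ω, ℝ)) : Set X :=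
  {x | x ∈ Ω ∧ ¬ ∃ (U : Set X) (f : X → ℝ), IsOpen U ∧ x ∈ U ∧ U ⊆ Ω ∧
    ContDiffOn ℝ ∞ f U ∧ IsGivenByOn T f U}

end Kernel

end

noncomputable section

/-! ### The greedy algorithm for linear matroids -/

/-! Since `h₁(g) = |g| - rk g`, a subgraph `g` is divergent iff `d * rk g ≤ (d - 2) * |g|`
(`isDivergent_iff`). Near a point `x` only the set `s` of edges whose form vanishes at `x` matters;
the other propagators are smooth and positive there.

Convergence: off the divergent locus, `(d - 2) * |γ| < d * rk γ` for all nonempty `γ ⊆ s`, and by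
finiteness `d` can be lowered to some `b < d` with `≤`. At each generic `y` near `x`, the greedy
basis for the weights `-log r_e`, where `r_e` is the length of the edge vector, is an independent `I
⊆ s` with `∏_s r_e^(2-d) ≤ ∏_I r_e^(-b)`. As `I` varies with `y`, the sum over all independent `I`
is the majorant. Edge vectors of an independent set are independent coordinates in `ℝ^d`, so each
summand is locally integrable.

Divergence: if a divergent `g` vanishes at `x`, a basis of `g` gives a surjection `L` onto a space
of dimension `d * rk g`, and the kernel is at least a constant times `‖L y‖^(-(d-2)|g|)`, which is
not integrable at the zero of `L`.

Singular support: the kernel is smooth off the singular locus and blows up on it, so no continuous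
function represents it there. -/

theorem finrank_span_image_eq_card {E W : Type*} [AddCommGroup W] [Module ℝ W]
    {f : E → W} {s I : Finset E} (hI : LinearIndepOn ℝ f (I : Set E))
    (hspan : Submodule.span ℝ (f '' I) = Submodule.span ℝ (f '' s)) :
    Module.finrank ℝ (Submodule.span ℝ (f '' s)) = I.card := by
  rw [← hspan, Set.image_eq_range]
  have := finrank_span_eq_card (R := ℝ) (b := fun i : (I : Set E) => f i) hI
  simpa using this

/-- If `a |γ| ≤ b rank γ` for all `γ ⊆ s`, then the greedy basis `I` of `s` for the weight `L`
satisfies `a ∑_s L ≤ b ∑_I L`. -/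
theorem exists_linearIndepOn_mul_sum_le {E W : Type*} [DecidableEq E] [AddCommGroup W]
    [Module ℝ W] (f : E → W) (L : E → ℝ) {a b : ℝ} (s : Finset E) (hL : ∀ e ∈ s, 0 ≤ L e)
    (h : ∀ γ ⊆ s, a * γ.card ≤ b * Module.finrank ℝ (Submodule.span ℝ (f '' (γ : Set E)))) :
    ∃ I ⊆ s, LinearIndepOn ℝ f (I : Set E) ∧ a * ∑ e ∈ s, L e ≤ b * ∑ e ∈ I, L e := by
  -- The shift `c` makes the induction work. Edges enter in order of decreasing weight, so a new
  -- edge `e` has weight zero after shifting by `L e`; lowering the shift from `L e` to `c` costs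
  -- only the cardinality bound for the whole set.
  suffices H : ∃ I ⊆ s, LinearIndepOn ℝ f (I : Set E) ∧
      Submodule.span ℝ (f '' (I : Set E)) = Submodule.span ℝ (f '' (s : Set E)) ∧
      ∀ c, (∀ e ∈ s, c ≤ L e) → a * ∑ e ∈ s, (L e - c) ≤ b * ∑ e ∈ I, (L e - c) by
    obtain ⟨I, hIs, hI, -, hle⟩ := H
    exact ⟨I, hIs, hI, by simpa using hle 0 hL⟩
  clear hL
  induction s using Finset.induction_on_min_value L with
  | empty => exact ⟨∅, by simp, by simp, by simp, by simp⟩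
  | insert e s hes hmin ih =>
    obtain ⟨I, hIs, hI, hspan, hle⟩ := ih fun γ hγ => h γ (hγ.trans (Finset.subset_insert _ _))
    obtain ⟨J, hJs, hJ, hJspan, hJsum⟩ : ∃ J ⊆ insert e s, LinearIndepOn ℝ f (J : Set E) ∧
        Submodule.span ℝ (f '' (J : Set E)) = Submodule.span ℝ (f '' (insert e s : Finset E)) ∧
        ∑ x ∈ J, (L x - L e) = ∑ x ∈ I, (L x - L e) := by
      by_cases he : f e ∈ Submodule.span ℝ (f '' (I : Set E))
      · refine ⟨I, hIs.trans (Finset.subset_insert _ _), hI, ?_, rfl⟩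
        rw [Finset.coe_insert, Set.image_insert_eq, Submodule.span_insert_eq_span (hspan ▸ he),
          hspan]
      · refine ⟨insert e I, Finset.insert_subset_insert _ hIs, ?_, ?_, ?_⟩
        · rw [Finset.coe_insert]
          exact hI.insert he
        · rw [Finset.coe_insert, Set.image_insert_eq, Finset.coe_insert, Set.image_insert_eq,
            Submodule.span_insert, hspan, ← Submodule.span_insert]
        · rw [Finset.sum_insert (fun h => hes (hIs h)), sub_self, zero_add]
    refine ⟨J, hJs, hJ, hJspan, fun c hc => ?_⟩
    have hcard := h _ subset_rfl
    rw [finrank_span_image_eq_card hJ hJspan] at hcard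
    have split : ∀ t : Finset E,
        ∑ x ∈ t, (L x - c) = ∑ x ∈ t, (L x - L e) + t.card * (L e - c) := fun t => by
      rw [← nsmul_eq_mul, ← Finset.sum_const, ← Finset.sum_add_distrib]
      exact Finset.sum_congr rfl fun _ _ => by ring
    have hce : 0 ≤ L e - c := sub_nonneg.2 (hc e (Finset.mem_insert_self _ _))
    have h1 : a * ∑ x ∈ insert e s, (L x - L e) ≤ b * ∑ x ∈ J, (L x - L e) := by
      rw [hJsum, Finset.sum_insert hes, sub_self, zero_add]
      exact hle _ hmin
    have h2 := mul_le_mul_of_nonneg_right hcard hce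
    rw [split, split]
    linarith

/-- Every finite family contains a basis of its span. -/
theorem exists_linearIndepOn_span_eq {E W : Type*} [AddCommGroup W] [Module ℝ W]
    (f : E → W) (s : Finset E) :
    ∃ I ⊆ s, LinearIndepOn ℝ f (I : Set E) ∧
      Submodule.span ℝ (f '' (I : Set E)) = Submodule.span ℝ (f '' (s : Set E)) := by
  classical
  induction s using Finset.induction_on with
  | empty => exact ⟨∅, by simp⟩
  | insert e s hes ih =>
    obtain ⟨I, hIs, hI, hspan⟩ := ih
    by_cases he : f e ∈ Submodule.span ℝ (f '' (I : Set E))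
    · refine ⟨I, hIs.trans (Finset.subset_insert _ _), hI, ?_⟩
      rw [Finset.coe_insert, Set.image_insert_eq, Submodule.span_insert_eq_span (hspan ▸ he),
        hspan]
    · refine ⟨insert e I, Finset.insert_subset_insert _ hIs, ?_, ?_⟩
      · rw [Finset.coe_insert]
        exact hI.insert he
      · rw [Finset.coe_insert, Set.image_insert_eq, Finset.coe_insert, Set.image_insert_eq,
          Submodule.span_insert, hspan, ← Submodule.span_insert]

/-! ### Local integrability and surjective linear maps -/

section Transfer

variable {X F : Type*} [NormedAddCommGroup X] [NormedSpace ℝ X] [FiniteDimensional ℝ X]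
  [MeasurableSpace X] [BorelSpace X] [NormedAddCommGroup F] [NormedSpace ℝ F]
  [FiniteDimensional ℝ F] [MeasurableSpace F] [BorelSpace F]

omit [BorelSpace F] in
-- Fubini: almost every slice of an integrable function is integrable, and conversely the second
-- factor may be cut down to a ball of finite measure.
theorem integrableAtFilter_comp_fst_prod_iff {K : Type*} [NormedAddCommGroup K] [NormedSpace ℝ K]
    [FiniteDimensional ℝ K] [MeasurableSpace K] [BorelSpace K] (ν : Measure F) (κ : Measure K)
    [ν.IsAddHaarMeasure] [κ.IsAddHaarMeasure] {f : F → ℝ} (p : F × K) :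
    IntegrableAtFilter (fun q : F × K => f q.1) (𝓝 p) (ν.prod κ) ↔
      IntegrableAtFilter f (𝓝 p.1) ν := by
  obtain ⟨p, k⟩ := p
  constructor
  · rintro ⟨s, hs, hf⟩
    obtain ⟨u, v, hu, hpu, hv, hkv, huv⟩ := mem_nhds_prod_iff'.1 hs
    refine ⟨u, hu.mem_nhds hpu, ?_⟩
    have hint := hf.mono_set huv
    rw [IntegrableOn, ← Measure.prod_restrict] at hint
    have hv0 : κ.restrict v ≠ 0 := by
      rw [Ne, Measure.restrict_eq_zero]
      exact (hv.measure_pos κ ⟨k, hkv⟩).ne'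
    have : NeZero (κ.restrict v) := ⟨hv0⟩
    obtain ⟨y, hy⟩ := hint.prod_left_ae.exists
    exact hy
  · rintro ⟨s, hs, hf⟩
    refine ⟨s ×ˢ Metric.closedBall k 1, prod_mem_nhds hs (Metric.closedBall_mem_nhds k one_pos), ?_⟩
    have : IsFiniteMeasure (κ.restrict (Metric.closedBall k 1)) :=
      ⟨by simpa using (isCompact_closedBall k 1).measure_lt_top⟩
    rw [IntegrableOn, ← Measure.prod_restrict]
    exact Integrable.comp_fst hf _

omit [FiniteDimensional ℝ X] in
theorem integrableAtFilter_comp_continuousLinearEquiv_iff (e : X ≃L[ℝ] F) (μ : Measure X)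
    (ν : Measure F) [μ.IsAddHaarMeasure] [ν.IsAddHaarMeasure] {f : F → ℝ} {x : X} :
    IntegrableAtFilter (f ∘ e) (𝓝 x) μ ↔ IntegrableAtFilter f (𝓝 (e x)) ν := by
  have hmap : (μ.map e).IsAddHaarMeasure := e.isAddHaarMeasure_map μ
  have hpos : 0 < (μ.map e).addHaarScalarFactor ν :=
    Measure.addHaarScalarFactor_pos_of_isAddHaarMeasure _ _
  have hsm := Measure.isAddLeftInvariant_eq_smul (μ.map e) ν
  have key : ∀ s : Set F, IntegrableOn f s ν ↔ IntegrableOn (f ∘ e) (e ⁻¹' s) μ := fun s => by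
    have hemb : IntegrableOn f s (μ.map e) ↔ IntegrableOn (f ∘ e) (e ⁻¹' s) μ :=
      e.toHomeomorph.measurableEmbedding.integrableOn_map_iff
    rw [← hemb, hsm, IntegrableOn, IntegrableOn, Measure.restrict_smul]
    exact (integrable_smul_measure (by simpa using hpos.ne') (by simp)).symm
  constructor
  · rintro ⟨s, hs, hf⟩
    refine ⟨e '' s, e.toHomeomorph.isOpenMap.image_mem_nhds hs, (key _).2 ?_⟩
    rwa [Set.preimage_image_eq _ e.injective]
  · rintro ⟨s, hs, hf⟩
    exact ⟨e ⁻¹' s, e.continuous.continuousAt hs, (key s).1 hf⟩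

/-- A complement of the kernel turns `L` into the first projection of a product, and linear
isomorphisms change Haar measure only by a positive factor. -/
theorem integrableAtFilter_comp_linearMap_iff {L : X →ₗ[ℝ] F} (hL : Function.Surjective L)
    (μ : Measure X) (ν : Measure F) [μ.IsAddHaarMeasure] [ν.IsAddHaarMeasure] {f : F → ℝ}
    {x : X} :
    IntegrableAtFilter (fun y => f (L y)) (𝓝 x) μ ↔ IntegrableAtFilter f (𝓝 (L x)) ν := by
  obtain ⟨q, hq⟩ := Submodule.exists_isCompl (LinearMap.ker L)
  let P : X →ₗ[ℝ] LinearMap.ker L := Submodule.projectionOnto _ q hq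
  let e : X ≃ₗ[ℝ] F × LinearMap.ker L :=
    LinearMap.equivProdOfSurjectiveOfIsCompl L P (LinearMap.range_eq_top.2 hL)
      (Submodule.range_projectionOnto hq) (by
        rw [show LinearMap.ker P = q from Submodule.ker_projectionOnto hq]; exact hq)
  have he : ∀ y, (e.toContinuousLinearEquiv y).1 = L y := fun y => rfl
  rw [← he x, ← integrableAtFilter_comp_fst_prod_iff ν Measure.addHaar,
    ← integrableAtFilter_comp_continuousLinearEquiv_iff e.toContinuousLinearEquiv μ]
  rfl

end Transfer

/-! ### Powers of the norm -/

section Powers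

variable {F : Type*} [NormedAddCommGroup F] [NormedSpace ℝ F] [FiniteDimensional ℝ F]
  [Nontrivial F] [MeasurableSpace F] [BorelSpace F] (ν : Measure F) [ν.IsAddHaarMeasure]

/-- In polar coordinates this is the integrability of `y ^ (n - 1 - b)` at `0`, with `n` the
dimension. -/
theorem integrableOn_ball_norm_rpow_neg_iff {r b : ℝ} (hr : 0 < r) :
    IntegrableOn (fun z : F => ‖z‖ ^ (-b)) (Metric.ball 0 r) ν ↔ b < Module.finrank ℝ F := by
  rw [integrableOn_fun_norm_addHaar ν (f := fun y : ℝ => y ^ (-b)),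
    integrableOn_congr_fun (g := fun y : ℝ => y ^ ((Module.finrank ℝ F : ℝ) - 1 - b)) ?_
      measurableSet_Ioo, intervalIntegral.integrableOn_Ioo_rpow_iff hr]
  · constructor <;> intro h <;> linarith
  · rintro y ⟨hy, -⟩
    have hpos : 1 ≤ Module.finrank ℝ F := Module.finrank_pos
    simp only [smul_eq_mul]
    rw [← Real.rpow_natCast, ← Real.rpow_add hy]
    push_cast [Nat.cast_sub hpos]
    ring_nf

theorem integrableAtFilter_norm_rpow_neg_iff {b : ℝ} :
    IntegrableAtFilter (fun z : F => ‖z‖ ^ (-b)) (𝓝 0) ν ↔ b < Module.finrank ℝ F := by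
  constructor
  · rintro ⟨s, hs, hf⟩
    obtain ⟨r, hr, hrs⟩ := Metric.mem_nhds_iff.1 hs
    exact (integrableOn_ball_norm_rpow_neg_iff ν hr).1 (hf.mono_set hrs)
  · exact fun h => ⟨_, Metric.ball_mem_nhds 0 one_pos,
      (integrableOn_ball_norm_rpow_neg_iff ν one_pos).2 h⟩

theorem integrableAtFilter_prod_norm_rpow_neg {ι : Type*} [Fintype ι] [SigmaFinite ν] {b : ℝ}
    (hb : b < Module.finrank ℝ F) :
    IntegrableAtFilter (fun z : ι → F => ∏ i, ‖z i‖ ^ (-b)) (𝓝 0) (Measure.pi fun _ => ν) := by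
  refine ⟨Set.univ.pi fun _ => Metric.ball 0 1,
    set_pi_mem_nhds Set.finite_univ fun _ _ => Metric.ball_mem_nhds _ one_pos, ?_⟩
  rw [IntegrableOn, Measure.restrict_pi_pi]
  exact Integrable.fintype_prod fun _ => (integrableOn_ball_norm_rpow_neg_iff ν one_pos).2 hb

end Powers

/-! ### The propagator -/

theorem propagator_eq_rpow (d : ℕ) (x : EuclideanSpace ℝ (Fin d)) :
    propagator d x = ‖x‖ ^ (-((d : ℝ) - 2)) := by
  rw [propagator, one_div, ← zpow_neg, ← Real.rpow_intCast]
  push_cast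
  rfl

theorem propagator_nonneg (d : ℕ) (x : EuclideanSpace ℝ (Fin d)) : 0 ≤ propagator d x := by
  rw [propagator_eq_rpow]; positivity

theorem measurable_propagator (d : ℕ) : Measurable (propagator d) := by
  simp_rw [funext (propagator_eq_rpow d)]
  fun_prop

theorem contDiffAt_propagator {d : ℕ} {x : EuclideanSpace ℝ (Fin d)} (hx : x ≠ 0) :
    ContDiffAt ℝ ∞ (propagator d) x := by
  rw [funext (propagator_eq_rpow d)]
  exact (contDiffAt_norm ℝ hx).rpow_const_of_ne (norm_ne_zero_iff.2 hx)

namespace OrientedMultigraph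

variable {V E : Type*} [Fintype V] [DecidableEq V] (G : OrientedMultigraph V E) (v₀ : V) (d : ℕ)

/-! ### The linear maps attached to the edges -/

/-- The coefficients `(v : e)`, `v ≠ v₀`, of the form attached to `e`. -/
def edgeRow (e : E) : {v : V // v ≠ v₀} → ℝ := fun v => G.sign v e

/-- The map `x ↦ ∑ v, (v : e) x_v`. -/
def edgeMap (e : E) : PositionSpace v₀ d →L[ℝ] EuclideanSpace ℝ (Fin d) :=
  ∑ v : {v : V // v ≠ v₀}, G.sign v e • ContinuousLinearMap.proj v

/-- The rank of the subgraph `g`. -/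
def edgeRank (g : Finset E) : ℕ :=
  Module.finrank ℝ (Submodule.span ℝ (G.edgeRow v₀ '' (g : Set E)))

variable {v₀ d}

theorem edgeMap_apply (e : E) (x : PositionSpace v₀ d) :
    G.edgeMap v₀ d e x = ∑ v : {v : V // v ≠ v₀}, G.sign v e • x v := by
  simp [edgeMap]

theorem edgeMap_apply_coord (e : E) (x : PositionSpace v₀ d) (i : Fin d) :
    G.edgeMap v₀ d e x i = ∑ v : {v : V // v ≠ v₀}, G.edgeRow v₀ e v * x v i := by
  simp [edgeMap_apply, edgeRow]

theorem feynmanKernel_eq [Fintype E] (x : PositionSpace v₀ d) :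
    G.feynmanKernel v₀ d x = ∏ e : E, propagator d (G.edgeMap v₀ d e x) := by
  simp [feynmanKernel, edgeMap_apply]

theorem feynmanKernel_nonneg [Fintype E] (x : PositionSpace v₀ d) :
    0 ≤ G.feynmanKernel v₀ d x :=
  Finset.prod_nonneg fun _ _ => propagator_nonneg _ _

theorem measurable_feynmanKernel [Fintype E] : Measurable (G.feynmanKernel v₀ d) := by
  rw [funext G.feynmanKernel_eq]
  exact Finset.measurable_fun_prod _ fun e _ =>
    (measurable_propagator d).comp (G.edgeMap v₀ d e).continuous.measurable

omit [Fintype V] in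
theorem edgeRow_ne_zero (e : E) : G.edgeRow v₀ e ≠ 0 := by
  intro h
  by_cases hs : G.src e = v₀
  · have ht : G.tgt e ≠ v₀ := fun ht => G.src_ne_tgt e (hs.trans ht.symm)
    have := congrFun h ⟨G.tgt e, ht⟩
    simp [edgeRow, sign, G.src_ne_tgt e] at this
  · have := congrFun h ⟨G.src e, hs⟩
    simp [edgeRow, sign] at this

/-- The family of edge maps of a set of edges with linearly independent rows is surjective. -/
theorem surjective_pi_edgeMap {I : Finset E} (hI : LinearIndepOn ℝ (G.edgeRow v₀) (I : Set E)) :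
    Function.Surjective
      (LinearMap.pi fun e : I => (G.edgeMap v₀ d e).toLinearMap) := by
  let M : Matrix I {v : V // v ≠ v₀} ℝ := Matrix.of fun e v => G.edgeRow v₀ e v
  have hM : Function.Surjective M.mulVecLin := by
    rw [← LinearMap.range_eq_top]
    apply Submodule.eq_top_of_finrank_eq
    rw [Module.finrank_fintype_fun_eq_card]
    exact LinearIndependent.rank_matrix (M := M) hI
  intro z
  -- The `d` coordinates decouple, so the scalar system is solved once for each of them.
  choose u hu using fun i : Fin d => hM fun e => z e i
  refine ⟨fun v => WithLp.toLp 2 fun i => u i v, ?_⟩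
  ext e i
  have := congrFun (hu i) e
  simp only [LinearMap.pi_apply, ContinuousLinearMap.coe_coe, edgeMap_apply_coord]
  exact this

theorem surjective_edgeMap (e : E) : Function.Surjective (G.edgeMap v₀ d e) := by
  intro z
  have hI : LinearIndepOn ℝ (G.edgeRow v₀) (({e} : Finset E) : Set E) := by
    rw [Finset.coe_singleton]
    exact LinearIndepOn.singleton (G.edgeRow_ne_zero e)
  obtain ⟨x, hx⟩ := G.surjective_pi_edgeMap (d := d) hI fun _ => z
  exact ⟨x, congrFun hx ⟨e, Finset.mem_singleton_self e⟩⟩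

/-- Discards the null set where some propagator takes its default value `1 / 0 = 0`; the pointwise
estimates below fail there. -/
theorem ae_edgeMap_ne_zero [Finite E] (hd : 0 < d) :
    ∀ᵐ x : PositionSpace v₀ d, ∀ e, G.edgeMap v₀ d e x ≠ 0 := by
  rw [ae_all_iff]
  intro e
  have : Nonempty (Fin d) := ⟨⟨0, hd⟩⟩
  have htop : LinearMap.ker (G.edgeMap v₀ d e).toLinearMap ≠ ⊤ := by
    intro h
    obtain ⟨z, hz⟩ := exists_ne (0 : EuclideanSpace ℝ (Fin d))
    obtain ⟨x, rfl⟩ := G.surjective_edgeMap (v₀ := v₀) e z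
    exact hz (LinearMap.mem_ker.1 (h ▸ Submodule.mem_top : x ∈ LinearMap.ker _))
  have := Measure.addHaar_submodule (volume : Measure (PositionSpace v₀ d)) _ htop
  rw [ae_iff]
  convert this using 2
  ext x
  exact not_not

/-! ### The first Betti number -/

theorem sum_sign (e : E) : ∑ v, G.sign v e = 0 := by
  have h : ∀ v, G.sign v e = (if G.src e = v then 1 else 0) - if G.tgt e = v then 1 else 0 := by
    intro v
    by_cases hs : G.src e = v
    · have : G.tgt e ≠ v := fun ht => G.src_ne_tgt e (hs.trans ht.symm)
      simp [sign, hs, this]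
    · by_cases ht : G.tgt e = v <;> simp [sign, hs, ht]
  simp [h, Finset.sum_sub_distrib]

theorem finrank_range_coboundary (g : Finset E) :
    Module.finrank ℝ (LinearMap.range (G.coboundary g)) = G.edgeRank v₀ g := by
  let M : Matrix g {v : V // v ≠ v₀} ℝ := Matrix.of fun e v => G.edgeRow v₀ e v
  have hrow : G.edgeRank v₀ g = M.rank := by
    rw [M.rank_eq_finrank_span_row, edgeRank, Set.image_eq_range]
    rfl
  rw [hrow, Matrix.rank]
  have hsplit : ∀ w : V → ℝ, ∑ v, w v = w v₀ + ∑ v : {v : V // v ≠ v₀}, w v := fun w => by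
    exact Fintype.sum_eq_add_sum_subtype_ne w v₀
  have happ : ∀ (y : V → ℝ) (e : g), G.coboundary g y e = ∑ v, G.sign v e * y v := fun y e => rfl
  have happ' : ∀ (y : {v : V // v ≠ v₀} → ℝ) (e : g),
      M.mulVecLin y e = ∑ v : {v : V // v ≠ v₀}, G.sign v e * y v := fun y e => rfl
  suffices h : LinearMap.range (G.coboundary g) = LinearMap.range M.mulVecLin by rw [h]
  apply le_antisymm
  · rintro _ ⟨y, rfl⟩
    -- The coboundary kills constants, so the value at `v₀` can be normalised to zero.
    refine ⟨fun v => y v - y v₀, ?_⟩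
    ext e
    have h0 : ∑ v, G.sign v e * (y v - y v₀) = ∑ v, G.sign v e * y v := by
      simp [mul_sub, Finset.sum_sub_distrib, ← Finset.sum_mul, sum_sign]
    rw [happ, happ', ← h0, hsplit]
    simp
  · rintro _ ⟨y, rfl⟩
    refine ⟨fun v => if h : v ≠ v₀ then y ⟨v, h⟩ else 0, ?_⟩
    ext e
    rw [happ, happ', hsplit]
    simp only [ne_eq, not_true_eq_false, dite_false, mul_zero, zero_add]
    exact Finset.sum_congr rfl fun v _ => by rw [dif_pos v.2]

theorem bettiOne_add_edgeRank (g : Finset E) : G.bettiOne g + G.edgeRank v₀ g = g.card := by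
  rw [← G.finrank_range_coboundary, bettiOne, Submodule.finrank_quotient_add_finrank]
  simp

theorem isDivergent_iff (g : Finset E) :
    G.IsDivergent d g ↔ (d : ℝ) * G.edgeRank v₀ g ≤ ((d : ℝ) - 2) * g.card := by
  have h := G.bettiOne_add_edgeRank (v₀ := v₀) g
  have hb : (G.bettiOne g : ℝ) = g.card - G.edgeRank v₀ g := by
    rw [← h]; push_cast; ring
  rw [IsDivergent, degDiv, ← Int.cast_le (R := ℝ)]
  push_cast
  rw [hb]
  constructor <;> intro h <;> linarith

/-! ### The arrangements -/

theorem mem_dualCoannihilator_edgeSpace {e : E} {x : PositionSpace v₀ d} :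
    x ∈ (G.edgeSpace v₀ d e).dualCoannihilator ↔ G.edgeMap v₀ d e x = 0 := by
  rw [Submodule.mem_dualCoannihilator]
  have hcoord : ∀ (x : PositionSpace v₀ d) i,
      G.edgeForm v₀ e (fun v => x v i) = G.edgeMap v₀ d e x i := fun x i => by
    simp [edgeForm, edgeMap_apply]
  constructor
  · intro h
    ext i
    refine h ((EuclideanSpace.proj i ∘L G.edgeMap v₀ d e : PositionSpace v₀ d →L[ℝ] ℝ) :
      PositionSpace v₀ d →ₗ[ℝ] ℝ) ⟨Pi.single i 1, fun y => ?_⟩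
    simp [hcoord, Pi.single_apply]
  · rintro h f ⟨α, hα⟩
    rw [hα]
    simp [hcoord, h]

theorem mem_dualCoannihilator_subgraphSpace {g : Finset E} {x : PositionSpace v₀ d} :
    x ∈ (G.subgraphSpace v₀ d g).dualCoannihilator ↔ ∀ e ∈ g, G.edgeMap v₀ d e x = 0 := by
  simp only [subgraphSpace, Submodule.dualCoannihilator_iSup_eq, Submodule.mem_iInf,
    mem_dualCoannihilator_edgeSpace]

theorem mem_singularLocus {x : PositionSpace v₀ d} :
    x ∈ G.singularLocus v₀ d ↔ ∃ e, G.edgeMap v₀ d e x = 0 := by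
  simp only [singularLocus, Set.mem_iUnion, SetLike.mem_coe, mem_dualCoannihilator_edgeSpace]

theorem mem_divergentLocus {x : PositionSpace v₀ d} :
    x ∈ G.divergentLocus v₀ d ↔
      ∃ g : Finset E, g.Nonempty ∧ G.IsDivergent d g ∧ ∀ e ∈ g, G.edgeMap v₀ d e x = 0 := by
  simp only [divergentLocus, Set.mem_iUnion, SetLike.mem_coe, mem_dualCoannihilator_subgraphSpace,
    exists_prop, and_assoc]

end OrientedMultigraph

/-! ### Pointwise domination -/

theorem MeasureTheory.IntegrableAtFilter.mono_of_ae {X : Type*} [TopologicalSpace X]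
    [MeasurableSpace X] [OpensMeasurableSpace X] {μ : Measure X} {f g : X → ℝ} {x : X}
    (hg : IntegrableAtFilter g (𝓝 x) μ) (hf : Measurable f) {P : X → Prop}
    (hP : ∀ᵐ y ∂μ, P y) (h : ∀ᶠ y in 𝓝 x, P y → ‖f y‖ ≤ g y) :
    IntegrableAtFilter f (𝓝 x) μ := by
  obtain ⟨s, hs, hgs⟩ := hg
  obtain ⟨t, hts, ht, hxt⟩ := mem_nhds_iff.1 (Filter.inter_mem hs h)
  refine ⟨t, ht.mem_nhds hxt,
    (hgs.mono_set (hts.trans Set.inter_subset_left)).mono' hf.aestronglyMeasurable ?_⟩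
  filter_upwards [ae_restrict_mem ht.measurableSet, ae_restrict_of_ae hP] with y hy hPy
  exact (hts hy).2 hPy

/-- A product of powers is dominated by a sum over independent sets, provided that the exponents
satisfy the rank conditions. -/
theorem prod_rpow_neg_le_sum_linearIndepOn {E W : Type*} [DecidableEq E] [AddCommGroup W]
    [Module ℝ W] (f : E → W) {a b : ℝ} (s : Finset E) {r : E → ℝ}
    (hr : ∀ e ∈ s, 0 < r e) (hr' : ∀ e ∈ s, r e ≤ 1)
    (h : ∀ γ ⊆ s, a * γ.card ≤ b * Module.finrank ℝ (Submodule.span ℝ (f '' (γ : Set E))))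
    (B : Finset (Finset E))
    (hB : ∀ I ⊆ s, LinearIndepOn ℝ f (I : Set E) → I ∈ B) (hBs : ∀ I ∈ B, I ⊆ s) :
    ∏ e ∈ s, r e ^ (-a) ≤ ∑ I ∈ B, ∏ e ∈ I, r e ^ (-b) := by
  -- The condition `r ≤ 1` makes the weights `-log r` nonnegative; exponentiating the greedy
  -- inequality compares the products.
  obtain ⟨I, hIs, hI, hle⟩ := exists_linearIndepOn_mul_sum_le f (fun e => -Real.log (r e)) s
    (fun e he => neg_nonneg.2 (Real.log_nonpos (hr e he).le (hr' e he))) h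
  have hexp : ∀ t ⊆ s, ∀ c : ℝ, ∏ e ∈ t, r e ^ (-c) =
      Real.exp (c * ∑ e ∈ t, -Real.log (r e)) := fun t ht c => by
    rw [Finset.mul_sum, Real.exp_sum]
    refine Finset.prod_congr rfl fun e he => ?_
    rw [Real.rpow_def_of_pos (hr e (ht he))]
    ring_nf
  calc ∏ e ∈ s, r e ^ (-a) ≤ ∏ e ∈ I, r e ^ (-b) := by
        rw [hexp s subset_rfl, hexp I hIs]
        exact Real.exp_le_exp.2 hle
    _ ≤ _ := Finset.single_le_sum (f := fun I => ∏ e ∈ I, r e ^ (-b))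
        (fun J hJ => Finset.prod_nonneg fun e he =>
          Real.rpow_nonneg (hr e (hBs J hJ he)).le _) (hB I hIs hI)

namespace OrientedMultigraph

variable {V E : Type*} [Fintype V] [DecidableEq V] (G : OrientedMultigraph V E) {v₀ : V} {d : ℕ}

theorem eventually_norm_edgeMap_lt [Finite E] (x : PositionSpace v₀ d) :
    ∀ᶠ y in 𝓝 x, ∀ e, ‖G.edgeMap v₀ d e y‖ < ‖G.edgeMap v₀ d e x‖ + 1 :=
  Filter.eventually_all.2 fun e =>
    ((G.edgeMap v₀ d e).continuous.norm.tendsto x).eventually_lt_const (lt_add_one _)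

/-! ### Power counting: convergence -/

theorem integrableAtFilter_prod_edgeMap (hd : 0 < d) {b : ℝ} (hb : b < d) {I : Finset E}
    (hI : LinearIndepOn ℝ (G.edgeRow v₀) (I : Set E)) {x : PositionSpace v₀ d}
    (hx : ∀ e ∈ I, G.edgeMap v₀ d e x = 0) :
    IntegrableAtFilter (fun y => ∏ e ∈ I, ‖G.edgeMap v₀ d e y‖ ^ (-b)) (𝓝 x) volume := by
  have : Nonempty (Fin d) := ⟨⟨0, hd⟩⟩
  have h := integrableAtFilter_prod_norm_rpow_neg (ι := I)
    (volume : Measure (EuclideanSpace ℝ (Fin d))) (b := b) (by simpa using hb)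
  have hL := integrableAtFilter_comp_linearMap_iff (G.surjective_pi_edgeMap (d := d) hI)
    (volume : Measure (PositionSpace v₀ d))
    (Measure.pi fun _ => (volume : Measure (EuclideanSpace ℝ (Fin d))))
    (f := fun z => ∏ i, ‖z i‖ ^ (-b)) (x := x)
  have hzero : (LinearMap.pi fun e : I => (G.edgeMap v₀ d e).toLinearMap) x = 0 := by
    ext1 e
    exact hx e e.2
  rw [hzero] at hL
  convert hL.2 h using 2 with y
  exact (Finset.prod_coe_sort I fun e => ‖G.edgeMap v₀ d e y‖ ^ (-b)).symm

/-- Each strict inequality at `b = d` survives for `b` slightly below `d`, and there are only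
finitely many `γ`. -/
theorem exists_lt_forall_card_le_rank {s : Finset E}
    (h : ∀ γ ⊆ s, γ.Nonempty → ¬ G.IsDivergent d γ) :
    ∃ b : ℝ, b < d ∧ ∀ γ ⊆ s, ((d : ℝ) - 2) * γ.card ≤ b * G.edgeRank v₀ γ := by
  classical
  have key : ∀ γ ∈ s.powerset, ∀ᶠ b in 𝓝[<] (d : ℝ),
      ((d : ℝ) - 2) * γ.card ≤ b * G.edgeRank v₀ γ := by
    intro γ hγ
    obtain rfl | hne := γ.eq_empty_or_nonempty
    · have : G.edgeRank v₀ ∅ = 0 := by rw [edgeRank, Finset.coe_empty, Set.image_empty]; simp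
      simp [this]
    · have hlt := h γ (Finset.mem_powerset.1 hγ) hne
      rw [G.isDivergent_iff (v₀ := v₀), not_le] at hlt
      have hc : ContinuousAt (fun b : ℝ => b * G.edgeRank v₀ γ) d := by fun_prop
      exact ((hc.tendsto.mono_left nhdsWithin_le_nhds).eventually_const_lt hlt).mono
        fun _ => le_of_lt
  obtain ⟨b, hb, hb'⟩ := (((Filter.eventually_all_finset s.powerset).2 key).and
    self_mem_nhdsWithin).exists
  exact ⟨b, hb', fun γ hγ => hb γ (Finset.mem_powerset.2 hγ)⟩

theorem integrableAtFilter_feynmanKernel [Fintype E] (hd : 2 < d) {x : PositionSpace v₀ d}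
    (hx : x ∉ G.divergentLocus v₀ d) :
    IntegrableAtFilter (G.feynmanKernel v₀ d) (𝓝 x) volume := by
  classical
  let s : Finset E := Finset.univ.filter fun e => G.edgeMap v₀ d e x = 0
  have hs : ∀ e, e ∈ s ↔ G.edgeMap v₀ d e x = 0 := fun e => by simp [s]
  obtain ⟨b, hbd, hb⟩ := G.exists_lt_forall_card_le_rank (v₀ := v₀) (s := s)
    fun γ hγ hne hdiv => hx (G.mem_divergentLocus.2 ⟨γ, hne, hdiv, fun e he => (hs e).1 (hγ he)⟩)
  let B : Finset (Finset E) :=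
    s.powerset.filter fun I => LinearIndepOn ℝ (G.edgeRow v₀) (I : Set E)
  have hcont : ContinuousAt (fun y => ∏ e ∈ sᶜ, propagator d (G.edgeMap v₀ d e y)) x := by
    refine tendsto_finsetProd _ fun e he => ?_
    have hne : G.edgeMap v₀ d e x ≠ 0 := fun h => Finset.mem_compl.1 he ((hs e).2 h)
    exact (contDiffAt_propagator hne).continuousAt.comp (G.edgeMap v₀ d e).continuous.continuousAt
  obtain ⟨C, hC⟩ : ∃ C, ∀ᶠ y in 𝓝 x, ∏ e ∈ sᶜ, propagator d (G.edgeMap v₀ d e y) < C :=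
    ⟨_, hcont.tendsto.eventually_lt_const (lt_add_one _)⟩
  have hsum : IntegrableAtFilter
      (fun y => ∑ I ∈ B, ∏ e ∈ I, ‖G.edgeMap v₀ d e y‖ ^ (-b)) (𝓝 x) volume := by
    have := Finset.sum_induction (s := B)
      (fun I (y : PositionSpace v₀ d) => ∏ e ∈ I, ‖G.edgeMap v₀ d e y‖ ^ (-b))
      (fun f => IntegrableAtFilter f (𝓝 x) volume) (fun _ _ hf hg => hf.add hg)
      ⟨Set.univ, Filter.univ_mem, integrable_zero _ _ _⟩ fun I hI => by
        obtain ⟨hIs, hI⟩ := Finset.mem_filter.1 hI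
        exact G.integrableAtFilter_prod_edgeMap (by lia) hbd hI
          fun e he => (hs e).1 (Finset.mem_powerset.1 hIs he)
    simpa only [Finset.sum_fn] using this
  obtain ⟨u, hu, hint⟩ := hsum
  have hsumC : IntegrableAtFilter
      (fun y => (∑ I ∈ B, ∏ e ∈ I, ‖G.edgeMap v₀ d e y‖ ^ (-b)) * C) (𝓝 x) volume :=
    ⟨u, hu, Integrable.mul_const hint C⟩
  refine hsumC.mono_of_ae G.measurable_feynmanKernel (G.ae_edgeMap_ne_zero (by lia)) ?_
  filter_upwards [hC, G.eventually_norm_edgeMap_lt x] with y hyC hy hne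
  rw [Real.norm_of_nonneg (G.feynmanKernel_nonneg y), feynmanKernel_eq,
    ← Finset.prod_mul_prod_compl s]
  refine mul_le_mul ?_ hyC.le (Finset.prod_nonneg fun _ _ => propagator_nonneg _ _)
    (Finset.sum_nonneg fun _ _ => Finset.prod_nonneg fun _ _ => by positivity)
  simp_rw [propagator_eq_rpow]
  refine prod_rpow_neg_le_sum_linearIndepOn (G.edgeRow v₀) s (r := fun e => ‖G.edgeMap v₀ d e y‖)
    (fun e _ => norm_pos_iff.2 (hne e)) (fun e he => ?_) hb B
    (fun I hIs hI => Finset.mem_filter.2 ⟨Finset.mem_powerset.2 hIs, hI⟩)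
    (fun I hI => Finset.mem_powerset.1 (Finset.mem_filter.1 hI).1)
  -- For an edge vanishing at `x` the bound `‖edgeMap x‖ + 1` equals `1`, as the domination lemma
  -- requires.
  have := hy e
  rw [(hs e).1 he, norm_zero, zero_add] at this
  exact this.le

/-! ### Power counting: divergence -/

/-- Edge lengths are bounded near `x` and the propagator decreases with length, so the factors
outside `g` stay above a positive constant. -/
theorem exists_mul_prod_propagator_le_feynmanKernel [Fintype E] (hd : 2 < d) (g : Finset E)
    (x : PositionSpace v₀ d) :
    ∃ c > 0, ∀ᶠ y in 𝓝 x, (∀ e, G.edgeMap v₀ d e y ≠ 0) →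
      c * ∏ e ∈ g, propagator d (G.edgeMap v₀ d e y) ≤ G.feynmanKernel v₀ d y := by
  classical
  refine ⟨∏ e ∈ gᶜ, (‖G.edgeMap v₀ d e x‖ + 1) ^ (-((d : ℝ) - 2)),
    Finset.prod_pos fun e _ => by positivity, ?_⟩
  filter_upwards [G.eventually_norm_edgeMap_lt x] with y hy hne
  rw [feynmanKernel_eq, ← Finset.prod_compl_mul_prod g]
  refine mul_le_mul_of_nonneg_right ?_ (Finset.prod_nonneg fun _ _ => propagator_nonneg _ _)
  refine Finset.prod_le_prod (fun e _ => by positivity) fun e _ => ?_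
  have : (2 : ℝ) < d := by exact_mod_cast hd
  rw [propagator_eq_rpow]
  exact Real.rpow_le_rpow_of_nonpos (norm_pos_iff.2 (hne e)) (hy e).le (by linarith)

theorem exists_norm_edgeMap_le_of_mem_span {I : Finset E} {e : E}
    (he : G.edgeRow v₀ e ∈ Submodule.span ℝ (G.edgeRow v₀ '' (I : Set E))) :
    ∃ K, 0 ≤ K ∧ ∀ y : PositionSpace v₀ d, ‖G.edgeMap v₀ d e y‖ ≤
      K * ‖(LinearMap.pi fun e : I => (G.edgeMap v₀ d e).toLinearMap) y‖ := by
  set L := LinearMap.pi fun e : I => (G.edgeMap v₀ d e).toLinearMap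
  suffices H : ∃ K, 0 ≤ K ∧ ∀ y : PositionSpace v₀ d,
      ‖∑ v : {v : V // v ≠ v₀}, G.edgeRow v₀ e v • y v‖ ≤ K * ‖L y‖ by
    simpa only [edgeMap_apply, edgeRow] using H
  generalize G.edgeRow v₀ e = w at he ⊢
  induction he using Submodule.span_induction with
  | mem w hw =>
    obtain ⟨i, hi, rfl⟩ := hw
    refine ⟨1, zero_le_one, fun y => ?_⟩
    rw [one_mul]
    refine le_trans (le_of_eq ?_) (norm_le_pi_norm (L y) ⟨i, hi⟩)
    exact congrArg norm (G.edgeMap_apply i y).symm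
  | zero => exact ⟨0, le_rfl, fun y => by simp⟩
  | add w w' _ _ ih ih' =>
    obtain ⟨K, hK, h⟩ := ih
    obtain ⟨K', hK', h'⟩ := ih'
    refine ⟨K + K', add_nonneg hK hK', fun y => ?_⟩
    simp only [Pi.add_apply, add_smul, Finset.sum_add_distrib, add_mul]
    exact norm_add_le_of_le (h y) (h' y)
  | smul c w _ ih =>
    obtain ⟨K, hK, h⟩ := ih
    refine ⟨|c| * K, by positivity, fun y => ?_⟩
    simp only [Pi.smul_apply, smul_assoc, ← Finset.smul_sum, norm_smul, Real.norm_eq_abs, mul_assoc]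
    exact mul_le_mul_of_nonneg_left (h y) (abs_nonneg c)

theorem not_integrableAtFilter_feynmanKernel [Fintype E] (hd : 2 < d) {x : PositionSpace v₀ d}
    (hx : x ∈ G.divergentLocus v₀ d) :
    ¬ IntegrableAtFilter (G.feynmanKernel v₀ d) (𝓝 x) volume := by
  intro hint
  obtain ⟨g, ⟨e₀, he₀⟩, hdiv, hg⟩ := G.mem_divergentLocus.1 hx
  rw [G.isDivergent_iff (v₀ := v₀)] at hdiv
  obtain ⟨I, hIg, hI, hspan⟩ := exists_linearIndepOn_span_eq (G.edgeRow v₀) g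
  have hcard : G.edgeRank v₀ g = I.card := finrank_span_image_eq_card hI hspan
  have hmem : ∀ e ∈ g, G.edgeRow v₀ e ∈ Submodule.span ℝ (G.edgeRow v₀ '' (I : Set E)) :=
    fun e he => hspan ▸ Submodule.subset_span ⟨e, he, rfl⟩
  -- Makes the target of `L` nontrivial, as the criterion for powers of the norm requires.
  have hIne : I.Nonempty := by
    rw [Finset.nonempty_iff_ne_empty]
    rintro rfl
    exact G.edgeRow_ne_zero (v₀ := v₀) e₀ (by simpa using hmem e₀ he₀)
  have : Nonempty I := hIne.to_subtype
  have : Nonempty (Fin d) := ⟨⟨0, by lia⟩⟩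
  have ha : 0 < (d : ℝ) - 2 := sub_pos.2 (by exact_mod_cast hd)
  set a : ℝ := (d : ℝ) - 2
  have hsurj := G.surjective_pi_edgeMap (d := d) hI
  set L := LinearMap.pi fun e : I => (G.edgeMap v₀ d e).toLinearMap with hL
  have hLx : L x = 0 := by
    ext1 e
    exact hg e (hIg e.2)
  obtain ⟨K, hK, hKle⟩ : ∃ K, 0 < K ∧ ∀ e ∈ g, ∀ y, ‖G.edgeMap v₀ d e y‖ ≤ K * ‖L y‖ := by
    choose! K hK h using fun e (he : e ∈ g) =>
      G.exists_norm_edgeMap_le_of_mem_span (d := d) (hmem e he)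
    refine ⟨∑ e ∈ g, K e + 1, add_pos_of_nonneg_of_pos (Finset.sum_nonneg hK) one_pos,
      fun e he y => (h e he y).trans (mul_le_mul_of_nonneg_right ?_ (norm_nonneg _))⟩
    exact (Finset.single_le_sum hK he).trans (le_add_of_nonneg_right zero_le_one)
  obtain ⟨c, hc, hle⟩ := G.exists_mul_prod_propagator_le_feynmanKernel hd g x
  have hLm : Measurable L := L.continuous_of_finiteDimensional.measurable
  have hpow : IntegrableAtFilter (fun y => (c * (K ^ (-a)) ^ g.card) * ‖L y‖ ^ (-(a * g.card)))
      (𝓝 x) volume := by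
    refine hint.mono_of_ae (by fun_prop) (G.ae_edgeMap_ne_zero (by lia)) ?_
    filter_upwards [hle] with y hy hne
    refine le_trans ?_ (hy hne)
    rw [Real.norm_of_nonneg (by positivity), mul_assoc]
    refine mul_le_mul_of_nonneg_left ?_ hc.le
    rw [← neg_mul, Real.rpow_mul_natCast (norm_nonneg _), ← mul_pow,
      ← Real.mul_rpow hK.le (norm_nonneg _), ← Finset.prod_const]
    refine Finset.prod_le_prod (fun e _ => by positivity) fun e he => ?_
    rw [propagator_eq_rpow]
    exact Real.rpow_le_rpow_of_nonpos (norm_pos_iff.2 (hne e)) (hKle e he y) (by linarith)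
  obtain ⟨u, hu, hint'⟩ := hpow
  have hc' : c * (K ^ (-a)) ^ g.card ≠ 0 := by positivity
  have hpow' : IntegrableAtFilter (fun y => ‖L y‖ ^ (-(a * g.card))) (𝓝 x) volume :=
    ⟨u, hu, (integrable_const_mul_iff (IsUnit.mk0 _ hc') _).1 hint'⟩
  have hF := (integrableAtFilter_comp_linearMap_iff hsurj volume
    (volume : Measure (I → EuclideanSpace ℝ (Fin d)))
    (f := fun z => ‖z‖ ^ (-(a * g.card)))).1 hpow'
  rw [hLx, integrableAtFilter_norm_rpow_neg_iff] at hF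
  have hfin : Module.finrank ℝ (I → EuclideanSpace ℝ (Fin d)) = I.card * d := by
    simp [Module.finrank_pi_fintype]
  rw [hfin] at hF
  rw [hcard] at hdiv
  push_cast at hF
  -- Integrability would force `a * |g| < d * |I|`, while divergence says `d * |I| ≤ a * |g|`.
  linarith

/-! ### The singular support -/

theorem contDiffAt_feynmanKernel [Fintype E] {x : PositionSpace v₀ d}
    (hx : x ∉ G.singularLocus v₀ d) : ContDiffAt ℝ ∞ (G.feynmanKernel v₀ d) x := by
  rw [funext G.feynmanKernel_eq]
  refine contDiffAt_prod fun e _ => ?_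
  have hne : G.edgeMap v₀ d e x ≠ 0 := fun h => hx (G.mem_singularLocus.2 ⟨e, h⟩)
  exact (contDiffAt_propagator hne).comp x (G.edgeMap v₀ d e).contDiff.contDiffAt

theorem isClosed_singularLocus [Finite E] : IsClosed (G.singularLocus v₀ d) :=
  isClosed_iUnion_of_finite fun _ => Submodule.closed_of_finiteDimensional _

/-- Near a singular point, the Feynman kernel does not agree almost everywhere with a continuous
function. -/
theorem not_ae_eq_of_mem_singularLocus [Fintype E] (hd : 2 < d) {x : PositionSpace v₀ d}
    (hx : x ∈ G.singularLocus v₀ d) {f : PositionSpace v₀ d → ℝ} (hf : ContinuousAt f x)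
    {U : Set (PositionSpace v₀ d)} (hU : U ∈ 𝓝 x) :
    ¬ ∀ᵐ y, y ∈ U → G.feynmanKernel v₀ d y = f y := by
  intro hae
  obtain ⟨e, he⟩ := G.mem_singularLocus.1 hx
  have : Nonempty (Fin d) := ⟨⟨0, by lia⟩⟩
  have ha : 0 < (d : ℝ) - 2 := sub_pos.2 (by exact_mod_cast hd)
  obtain ⟨c, hc, hle⟩ := G.exists_mul_prod_propagator_le_feynmanKernel hd {e} x
  have hlarge : ∀ᶠ t in 𝓝[>] (0 : ℝ), (f x + 1) / c < t ^ (-((d : ℝ) - 2)) :=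
    (tendsto_rpow_neg_nhdsGT_zero (neg_lt_zero.2 ha)).eventually_gt_atTop _
  obtain ⟨δ, hδ, hδlarge⟩ : ∃ δ > 0, ∀ t, 0 < t → t < δ →
      (f x + 1) / c < t ^ (-((d : ℝ) - 2)) := by
    obtain ⟨δ, hδ, h⟩ := mem_nhdsGT_iff_exists_Ioo_subset.1 hlarge
    exact ⟨δ, hδ, fun t ht ht' => h ⟨ht, ht'⟩⟩
  have hsmall : ∀ᶠ y in 𝓝 x, ‖G.edgeMap v₀ d e y‖ < δ := by
    refine ((G.edgeMap v₀ d e).continuous.norm.tendsto x).eventually_lt_const ?_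
    rwa [he, norm_zero]
  have hfx : ∀ᶠ y in 𝓝 x, f y < f x + 1 := hf.tendsto.eventually_lt_const (lt_add_one _)
  obtain ⟨W, hW, hWo, hxW⟩ := mem_nhds_iff.1
    (Filter.inter_mem (Filter.inter_mem hU hle) (Filter.inter_mem hsmall hfx))
  -- At almost every point of `W` the kernel would exceed `f x + 1` and yet equal `f y < f x + 1`;
  -- so the nonempty open set `W` would be null.
  have hzero : ∀ᵐ y, y ∉ W := by
    filter_upwards [hae, G.ae_edgeMap_ne_zero (v₀ := v₀) (d := d) (by lia)] with y hy hne hyW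
    obtain ⟨⟨hyU, hyle⟩, hyδ, hyf⟩ := hW hyW
    have h1 := hyle hne
    rw [Finset.prod_singleton, propagator_eq_rpow, hy hyU] at h1
    have h2 := hδlarge _ (norm_pos_iff.2 (hne e)) hyδ
    rw [div_lt_iff₀ hc] at h2
    linarith [show f y < f x + 1 from hyf]
  refine (hWo.measure_pos volume ⟨x, hxW⟩).ne' ?_
  simpa [ae_iff] using hzero

end OrientedMultigraph

end

/-! ### The distribution and its singular support -/

theorem proposition2p2 {V E : Type*} [Fintype V] [DecidableEq V] [Fintype E]
    (G : OrientedMultigraph V E) (v₀ : V) (d : ℕ) (hd : 2 < d)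
    (hconn : G.IsConnected) (hlog : G.IsAtMostLogarithmic d) :
    (∃ T : 𝓓'(G.convergentRegion v₀ d, ℝ),
      IsGivenByOn T (G.feynmanKernel v₀ d) (G.convergentRegion v₀ d) ∧
      singularSupport T = G.singularLocus v₀ d \ G.divergentLocus v₀ d) ∧
    (∀ x ∈ G.divergentLocus v₀ d,
      ¬ IntegrableAtFilter (G.feynmanKernel v₀ d) (𝓝 x) volume) := by
  refine ⟨?_, fun x hx => G.not_integrableAtFilter_feynmanKernel hd hx⟩
  have hloc : LocallyIntegrableOn (G.feynmanKernel v₀ d)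
      (G.convergentRegion v₀ d : Set (PositionSpace v₀ d)) volume := fun x hx =>
    (G.integrableAtFilter_feynmanKernel hd hx).filter_mono nhdsWithin_le_nhds
  let T : 𝓓'(G.convergentRegion v₀ d, ℝ) :=
    TestFunction.integralAgainstBilinCLM (ContinuousLinearMap.mul ℝ ℝ) volume
      (G.feynmanKernel v₀ d)
  have hT : ∀ φ : 𝓓(G.convergentRegion v₀ d, ℝ), T φ = ∫ x, G.feynmanKernel v₀ d x * φ x :=
    fun φ => by
      refine (TestFunction.integralAgainstBilinCLM_eq_integral hloc).trans ?_
      simp only [ContinuousLinearMap.mul_apply', mul_comm]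
  refine ⟨T, ⟨hloc, fun φ _ => hT φ⟩, ?_⟩
  ext x
  constructor
  · rintro ⟨hxΩ, hx⟩
    refine ⟨by_contra fun hxs => hx ?_, hxΩ⟩
    let U : Set (PositionSpace v₀ d) := (G.convergentRegion v₀ d) ∩ (G.singularLocus v₀ d)ᶜ
    have hU : IsOpen U := (G.convergentRegion v₀ d).isOpen.inter G.isClosed_singularLocus.isOpen_compl
    exact ⟨U, G.feynmanKernel v₀ d, hU, ⟨hxΩ, hxs⟩, Set.inter_subset_left,
      fun y hy => (G.contDiffAt_feynmanKernel hy.2).contDiffWithinAt,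
      hloc.mono_set Set.inter_subset_left, fun φ _ => hT φ⟩
  · rintro ⟨hxs, hxΩ⟩
    refine ⟨hxΩ, ?_⟩
    rintro ⟨U, f, hU, hxU, hUΩ, hfU, hfloc, hfT⟩
    refine G.not_ae_eq_of_mem_singularLocus hd hxs
      (hfU.continuousOn.continuousAt (hU.mem_nhds hxU)) (hU.mem_nhds hxU) ?_
    have hvU := hloc.mono_set hUΩ
    -- Fundamental lemma of the calculus of variations: the kernel and `f` have equal integrals
    -- against all test functions supported in `U`, so they agree almost everywhere on `U`.
    have hae := hU.ae_eq_zero_of_integral_contDiff_smul_eq_zero (hvU.sub hfloc)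
      fun ψ hψ hψc hψU => by
        let φ : 𝓓(G.convergentRegion v₀ d, ℝ) := ⟨ψ, hψ, hψc, hψU.trans hUΩ⟩
        have hφ : ∀ y, φ y = ψ y := fun _ => rfl
        have h := (hT φ).symm.trans (hfT φ hψU)
        simp only [hφ] at h
        have hi : ∀ w : PositionSpace v₀ d → ℝ, LocallyIntegrableOn w U volume →
            Integrable (fun y => w y * ψ y) volume := fun w hw => by
          have := TestFunction.integrable_bilin (Ω := ⟨U, hU⟩) (ContinuousLinearMap.mul ℝ ℝ) hw
            (⟨ψ, hψ, hψc, hψU⟩ : 𝓓(⟨U, hU⟩, ℝ))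
          refine this.congr (.of_forall fun y => ?_)
          exact mul_comm _ _
        simp only [smul_eq_mul, Pi.sub_apply, mul_comm (ψ _), sub_mul]
        rw [integral_sub (hi _ hvU) (hi _ hfloc), h, sub_self]
    filter_upwards [hae] with y hy hyU
    exact sub_eq_zero.1 (hy hyU)
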